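/- Let $\mathsf{Ch}^*_{\mathbb{Q}}$ be the category of non-negatively graded cochain complexes of $\mathbb{Q}$-vector spaces (differentials raise degree), and let $p\mathsf{Ch}^*_{\mathbb{Q}} = \mathsf{Fun}([0,\infty), \mathsf{Ch}^*_{\mathbb{Q}})$ be the category of functors from the poset $[0,\infty)$ to it. For $k \in \mathbb{N} = \{0,1,2,\dots\}$ let $S^k$ be the complex with $\mathbb{Q}$ in degree $k$ and zero elsewhere. For $k\ge 1$ let $D^k$ be the complex with $\mathbb{Q}$ in degrees $k-1$ and $k$, zero elsewhere, and with the identity as its only nonzero differential; put $D^0 = 0$. Let $S^k \to D^k$ be the canonical map (the identity in degree $k$ if $k\geq 1$, and zero if $k=0$). For real numbers $0 \le s < t$ define the following objects of $p\mathsf{Ch}^*_{\mathbb{Q}}$: - $\mathbb{D}^k_s$ is the left Kan extension of $s \mapsto D^k$ along $\{s\} \subset [0,\infty)$; - $\mathbb{S}^k_{[s,t)}$ is the left Kan extension of $(s<t) \mapsto (S^k \to D^k)$ along $\{s<t\} \subset [0,\infty)$; - $\mathbb{S}^k_{[s,\infty)}$ is the left Kan extension of $s \mapsto S^k$ along $\{s\}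 \subset [0,\infty)$. There are canonical maps $\mathbb{S}^k_{[s,t)} \to \mathbb{D}^k_s$ (equal to $S^k \to D^k$ at times in $[s,t)$ and to the identity of $D^k$ at times $\ge t$), $\mathbb{S}^k_{[s,\infty)} \to \mathbb{D}^k_s$ (equal to $S^k\to D^k$ at times $\geq s$), and $\mathbb{D}^k_t \to \mathbb{D}^k_s$ (the identity of $D^k$ at times $\ge t$). Put $$\mathbb{I} = \{\mathbb{S}^k_{[s,t)} \to \mathbb{D}^k_s \mid k \in \mathbb{N},\ 0 \le s < t < \infty\} \cup \{\mathbb{S}^k_{[s,\infty)} \to \mathbb{D}^k_s \mid k \in \mathbb{N},\ 0 \le s < \infty\},$$ $$\mathbb{J} = \{\mathbb{D}^k_t \to \mathbb{D}^k_s \mid k \in \mathbb{N},\ 0 \le s < t < \infty\} \cup \{0 \to \mathbb{D}^k_s \mid k \in \mathbb{N},\ 0 \le s < \infty\}.$$ **Theorem (Interval-Sphere Model Structure).** The category $p\mathsf{Ch}^*_{\mathbb{Q}}$ has all small limits and colimits, and it carries a cofibrantly generated model structure (with functorial factorizations) whose weak equivalences are the pointwise quasi-isomorphisms, i.e. the maps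 $f : \mathbb{X} \to \mathbb{Y}$ such that every $f(r) : \mathbb{X}(r) \to \mathbb{Y}(r)$, $r \ge 0$, induces isomorphisms on cohomology, and for which $\mathbb{I}$ and $\mathbb{J}$ are sets of generating cofibrations and generating trivial cofibrations, respectively. That is, $\mathbb{I}$ and $\mathbb{J}$ permit the small object argument, the trivial fibrations are exactly the maps with the right lifting property with respect to $\mathbb{I}$, and the fibrations are exactly the maps with the right lifting property with respect to $\mathbb{J}$. -/

import Mathlib

open CategoryTheory Limits HomotopicalAlgebra
open scoped NNReal ZeroObject

noncomputable section

namespace PersistentComplex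

/-- Non-negatively graded cochain complexes of rational vector spaces. -/
abbrev Ch : Type 1 := CochainComplex (ModuleCat.{0} ℚ) ℕ

/-- Persistent cochain complexes: functors from the poset `[0, ∞)` to cochain complexes. -/
abbrev PCh : Type 1 := ℝ≥0 ⥤ Ch

/-- The one-dimensional rational vector space. -/
abbrev Q : ModuleCat.{0} ℚ := ModuleCat.of ℚ ℚ

/-- The cochain sphere: `ℚ` in degree `k` and zero elsewhere. -/
def sphere (k : ℕ) : Ch := (HomologicalComplex.single (ModuleCat.{0} ℚ) (.up ℕ) k).obj Q

/-- The cochain disk: for `k ≥ 1` it is `ℚ` in degrees `k - 1` and `k` with the identity as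
differential, and for `k = 0` it is zero. -/
def disk : ℕ → Ch
  | 0 => 0
  | k + 1 => HomologicalComplex.double (c := ComplexShape.up ℕ) (𝟙 Q) (i₀ := k) (i₁ := k + 1) rfl

/-- The canonical map `S^k ⟶ D^k`: the identity of `ℚ` in degree `k` if `k ≥ 1`, and the zero map
`S^0 ⟶ D^0 = 0` if `k = 0`. -/
def sphereToDisk : (k : ℕ) → (sphere k ⟶ disk k)
  | 0 => 0
  | k + 1 => HomologicalComplex.mkHomFromSingle
      (HomologicalComplex.doubleXIso₁ (c := ComplexShape.up ℕ) (𝟙 Q) (i₀ := k) rfl (by simp)).inv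
      (fun j _ => (congrArg _ (HomologicalComplex.double_d_eq_zero₀ (c := ComplexShape.up ℕ) (𝟙 Q)
        (i₀ := k) rfl (k + 1) j (by simp))).trans comp_zero)

/-- The inclusion `{s} ⥤ [0, ∞)`. -/
abbrev pointInclusion (s : ℝ≥0) : Discrete PUnit.{1} ⥤ ℝ≥0 := Functor.fromPUnit s

/-- The inclusion `{s < t} ⥤ [0, ∞)`, the poset `{s < t}` being `Fin 2 = {0 < 1}`. -/
abbrev pairInclusion {s t : ℝ≥0} (h : s < t) : Fin 2 ⥤ ℝ≥0 :=
  ComposableArrows.mk₁ (homOfLE h.le)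

/-- The left Kan extension along `{s} ⥤ [0, ∞)` of the functor with value `K`. -/
def extendPoint (s : ℝ≥0) (K : Ch) : PCh :=
  (pointInclusion s).leftKanExtension (Functor.fromPUnit K)

/-- The unit `K ⟶ (extendPoint s K)(s)`. -/
def extendPointUnit (s : ℝ≥0) (K : Ch) : K ⟶ (extendPoint s K).obj s :=
  ((pointInclusion s).leftKanExtensionUnit (Functor.fromPUnit K)).app ⟨⟨⟩⟩

/-- The morphism `extendPoint s K ⟶ X` that corresponds to `φ : K ⟶ X(s)`. -/
def extendPointDesc {s : ℝ≥0} {K : Ch} {X : PCh} (φ : K ⟶ X.obj s) : extendPoint s K ⟶ X :=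
  ((pointInclusion s).leftKanExtension (Functor.fromPUnit K)).descOfIsLeftKanExtension
    ((pointInclusion s).leftKanExtensionUnit (Functor.fromPUnit K)) X
    { app := fun _ => φ }

/-- The persistent disk `𝔻^k_s`. -/
def persistentDisk (k : ℕ) (s : ℝ≥0) : PCh := extendPoint s (disk k)

/-- The interval sphere `𝕊^k_{[s,t)}` for `s < t < ∞`: the left Kan extension of
`S^k ⟶ D^k` along `{s < t} ⥤ [0, ∞)`. -/
def intervalSphere (k : ℕ) {s t : ℝ≥0} (h : s < t) : PCh :=
  (pairInclusion h).leftKanExtension (ComposableArrows.mk₁ (sphereToDisk k))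

/-- The interval sphere `𝕊^k_{[s,∞)}`. -/
def intervalSphereInfty (k : ℕ) (s : ℝ≥0) : PCh := extendPoint s (sphere k)

/-- The canonical map `𝔻^k_t ⟶ 𝔻^k_s` for `s < t`: the identity of `D^k` at all times `≥ t`. -/
def diskToDisk (k : ℕ) {s t : ℝ≥0} (h : s < t) : persistentDisk k t ⟶ persistentDisk k s :=
  extendPointDesc
    (extendPointUnit s (disk k) ≫ (persistentDisk k s).map (homOfLE h.le))

/-- The canonical map `𝕊^k_{[s,∞)} ⟶ 𝔻^k_s`: it is `S^k ⟶ D^k` at all times `≥ s`. -/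
def intervalSphereInftyToDisk (k : ℕ) (s : ℝ≥0) :
    intervalSphereInfty k s ⟶ persistentDisk k s :=
  extendPointDesc (sphereToDisk k ≫ extendPointUnit s (disk k))

/-- The canonical map `𝕊^k_{[s,t)} ⟶ 𝔻^k_s`: it is `S^k ⟶ D^k` at times in `[s, t)` and the
identity of `D^k` at all times `≥ t`. -/
def intervalSphereToDisk (k : ℕ) {s t : ℝ≥0} (h : s < t) :
    intervalSphere k h ⟶ persistentDisk k s :=
  ((pairInclusion h).leftKanExtension
      (ComposableArrows.mk₁ (sphereToDisk k))).descOfIsLeftKanExtension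
    ((pairInclusion h).leftKanExtensionUnit (ComposableArrows.mk₁ (sphereToDisk k)))
    (persistentDisk k s)
    (ComposableArrows.homMk₁
      (sphereToDisk k ≫ extendPointUnit s (disk k))
      (extendPointUnit s (disk k) ≫ (persistentDisk k s).map (homOfLE h.le))
      (Category.assoc _ _ _).symm)

/-- The set `𝕀` of the maps `𝕊^k_{[s,t)} ⟶ 𝔻^k_s` (`k ∈ ℕ`, `0 ≤ s < t < ∞`) and
`𝕊^k_{[s,∞)} ⟶ 𝔻^k_s` (`k ∈ ℕ`, `0 ≤ s < ∞`). -/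
def setI : MorphismProperty PCh :=
  MorphismProperty.ofHoms
      (fun i : ℕ × { p : ℝ≥0 × ℝ≥0 // p.1 < p.2 } => intervalSphereToDisk i.1 i.2.2) ⊔
    MorphismProperty.ofHoms (fun i : ℕ × ℝ≥0 => intervalSphereInftyToDisk i.1 i.2)

/-- The set `𝕁` of the maps `𝔻^k_t ⟶ 𝔻^k_s` (`k ∈ ℕ`, `0 ≤ s < t < ∞`) and
`0 ⟶ 𝔻^k_s` (`k ∈ ℕ`, `0 ≤ s < ∞`). -/
def setJ : MorphismProperty PCh :=
  MorphismProperty.ofHoms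
      (fun i : ℕ × { p : ℝ≥0 × ℝ≥0 // p.1 < p.2 } => diskToDisk i.1 i.2.2) ⊔
    MorphismProperty.ofHoms
      (fun i : ℕ × ℝ≥0 => (0 : (0 : PCh) ⟶ persistentDisk i.1 i.2))

/-- The pointwise quasi-isomorphisms. -/
def pointwiseQuasiIso : MorphismProperty PCh :=
  (HomologicalComplex.quasiIso (ModuleCat.{0} ℚ) (.up ℕ)).functorCategory ℝ≥0

end PersistentComplex

universe v u

/-- A model structure is cofibrantly generated by `I` and `J` if both permit the small object
argument, the trivial fibrations are the maps with the right lifting property against `I`, and the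
fibrations are the maps with the right lifting property against `J`. In addition to the axioms of
`ModelCategory`, all small limits and colimits and functorial factorizations are required. -/
structure IsCofibrantlyGeneratedBy (C : Type u) [Category.{v} C] [ModelCategory C]
    (I J : MorphismProperty C) : Prop where
  hasLimits : HasLimits C
  hasColimits : HasColimits C
  functorialFactorization₁ :
    (cofibrations C).HasFunctorialFactorization (trivialFibrations C)
  functorialFactorization₂ :
    (trivialCofibrations C).HasFunctorialFactorization (fibrations C)
  smallObjectArgument_I : MorphismProperty.HasSmallObjectArgument.{v} I
  smallObjectArgument_J : MorphismProperty.HasSmallObjectArgument.{v} J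
  trivialFibrations_eq : trivialFibrations C = I.rlp
  fibrations_eq : fibrations C = J.rlp

end

/-! Maps out of `𝔻^{k+1}_s` are elements of degree `k` at time `s`, and maps out of interval spheres
are cocycles, with a chosen primitive at time `t` for `[s,t)`. Lifting against `𝕁` thus says that
`X(s) ⟶ Y(s)` and `X(s) ⟶ Y(s) ×_{Y(t)} X(t)` are degreewise surjective (`setJ_rlp_iff`); lifting
against `𝕀` asks for the same with prescribed differential (`setI_rlp_iff`). Two facts then carry
the proof.

First, `rlp 𝕀` is `rlp 𝕁` intersected with the weak equivalences (`setI_rlp_eq`). Lifting against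
`𝕀` twice, first the differential and then the element, gives lifting against `𝕁`. Conversely, a
lift at time `s` with the right differential is corrected by a coboundary, since the kernel of a
surjective quasi-isomorphism is acyclic.

Second, every map in `llp (rlp 𝕁)` is a weak equivalence (`pointwiseQuasiIso_of_setJ_rlp_llp`). The
right adjoint of evaluation at `r` sends degreewise surjections into `rlp 𝕁`, so the value of such a
map at `r` lifts against all degreewise surjections. Lifting against `A ⟶ 0` and against the path
fibration makes it a homotopy equivalence.

The retract argument identifies the trivial cofibrations with `llp (rlp 𝕁)` (`setJ_rlp_llp_eq`).
Local presentability supplies the small object argument, hence both functorial factorizations. -/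

noncomputable section

/-! ### Smallness in locally presentable categories -/

section

universe w

/-- A small family of objects of a locally presentable category is uniformly presentable. -/
lemma CategoryTheory.exists_cardinal_forall_isCardinalPresentable {C : Type u} [Category.{v} C]
    [IsLocallyPresentable.{w} C] {ι : Type w} (A : ι → C) :
    ∃ (κ : Cardinal.{w}) (_ : Fact κ.IsRegular), ∀ i, IsCardinalPresentable (A i) κ := by
  have h (i : ι) : IsPresentable.{w} (A i) := inferInstance
  choose κ₀ hκ₀ hA using fun i ↦ (h i).exists_cardinal
  obtain ⟨κ, hκ, hle⟩ := HasCardinalLT.exists_regular_cardinal_forall (fun i ↦ (κ₀ i).out)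
  have : Fact κ.IsRegular := ⟨hκ⟩
  refine ⟨κ, inferInstance, fun i ↦ ?_⟩
  have : IsCardinalPresentable (A i) (κ₀ i) := hA i
  have := (hasCardinalLT_iff_cardinal_mk_lt _ _).1 (hle i)
  rw [Cardinal.mk_out] at this
  exact isCardinalPresentable_of_le (A i) this.le

/-- In a locally presentable category, any small family of morphisms permits the small
object argument. -/
lemma CategoryTheory.MorphismProperty.hasSmallObjectArgument_of_isLocallyPresentable
    {C : Type u} [Category.{w} C] [IsLocallyPresentable.{w} C] [HasColimitsOfSize.{w, w} C]
    (I : MorphismProperty C) [MorphismProperty.IsSmall.{w} I] :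
    MorphismProperty.HasSmallObjectArgument.{w} I := by
  obtain ⟨ι, A, B, f, rfl⟩ := (MorphismProperty.isSmall_iff_eq_ofHoms.{w} I).1 inferInstance
  obtain ⟨κ, hκ, hA⟩ := exists_cardinal_forall_isCardinalPresentable.{w} A
  have : Nonempty κ.ord.ToType := by simpa using hκ.out.ne_zero
  have := WellFoundedLT.toOrderBot κ.ord.ToType
  refine ⟨κ, hκ, this, { preservesColimit := ?_ }⟩
  rintro _ _ X Y _ ⟨i⟩ g hg
  -- The well-order `κ.ord` is `κ`-filtered, so maps out of `A i` commute with colimits of its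
  -- chains.
  have := preservesColimitsOfShape_of_isCardinalPresentable (A i) κ κ.ord.ToType
  infer_instance

end

/-! ### Generators of disks and spheres -/

namespace PersistentComplex

/-- The linear map `ℚ ⟶ M` sending `1` to `x`. -/
def ofElement {M : ModuleCat.{0} ℚ} (x : M) : Q ⟶ M :=
  ModuleCat.ofHom (LinearMap.toSpanSingleton ℚ M x)

@[simp]
lemma ofElement_apply_one {M : ModuleCat.{0} ℚ} (x : M) : ofElement x (1 : ℚ) = x := by
  simp [ofElement]

lemma Q_hom_ext {M : ModuleCat.{0} ℚ} {f g : Q ⟶ M} (h : f (1 : ℚ) = g (1 : ℚ)) : f = g :=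
  ModuleCat.hom_ext (LinearMap.ext_ring h)

/-- The generator of the disk `D^{k+1}`, in degree `k`. -/
def diskGen (k : ℕ) : (disk (k + 1)).X k :=
  (HomologicalComplex.doubleXIso₀ (c := ComplexShape.up ℕ) (𝟙 Q) (i₀ := k) (i₁ := k + 1) rfl).inv
    (1 : ℚ)

/-- The morphism `D^{k+1} ⟶ X` that corresponds to an element of degree `k` of `X`. -/
def diskDesc {X : Ch} {k : ℕ} (x : X.X k) : disk (k + 1) ⟶ X :=
  HomologicalComplex.mkHomFromDouble (c := ComplexShape.up ℕ) (i₀ := k) (i₁ := k + 1) rfl (by simp)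
    (ofElement x) (ofElement x ≫ X.d k (k + 1)) (by simp) (by simp)

@[simp]
lemma diskDesc_gen {X : Ch} {k : ℕ} (x : X.X k) : (diskDesc x).f k (diskGen k) = x := by
  have h : (HomologicalComplex.doubleXIso₀ (c := ComplexShape.up ℕ) (𝟙 Q) (i₀ := k) (i₁ := k + 1)
      rfl).inv ≫ (diskDesc x).f k = ofElement x :=
    (Iso.inv_comp_eq _).2 (HomologicalComplex.mkHomFromDouble_f₀ ..)
  exact (ConcreteCategory.congr_hom h (1 : ℚ)).trans (ofElement_apply_one x)

/-- `D^{k+1}` corepresents `X ↦ Hom(ℚ, X^k)`; note the degree shift. -/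
lemma disk_hom_ext {X : Ch} {k : ℕ} {f g : disk (k + 1) ⟶ X}
    (h : f.f k (diskGen k) = g.f k (diskGen k)) : f = g := by
  let e := HomologicalComplex.evalCompCoyonedaCorepresentableByDoubleId
    (c := .up ℕ) (i₀ := k) (i₁ := k + 1) rfl (by simp) Q
  exact e.homEquiv.injective (Q_hom_ext h)

/-- The generator of the sphere `S^k`. -/
def sphereGen (k : ℕ) : (sphere k).X k :=
  (HomologicalComplex.singleObjXSelf (ComplexShape.up ℕ) k Q).inv (1 : ℚ)

lemma d_sphereGen (k j : ℕ) : (sphere k).d k j (sphereGen k) = 0 := by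
  have h : (sphere k).d k j = 0 := HomologicalComplex.single_obj_d ..
  rw [h]; rfl

/-- The morphism `S^k ⟶ X` that corresponds to a cocycle of degree `k` of `X`. -/
def sphereDesc {X : Ch} {k : ℕ} (x : X.X k) (hx : X.d k (k + 1) x = 0) : sphere k ⟶ X :=
  HomologicalComplex.mkHomFromSingle (ofElement x) (by
    rintro _ rfl
    exact Q_hom_ext ((congrArg (X.d k (k + 1)) (ofElement_apply_one x)).trans hx))

@[simp]
lemma sphereDesc_gen {X : Ch} {k : ℕ} (x : X.X k) (hx : X.d k (k + 1) x = 0) :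
    (sphereDesc x hx).f k (sphereGen k) = x := by
  have h : (HomologicalComplex.singleObjXSelf (ComplexShape.up ℕ) k Q).inv ≫
      (sphereDesc x hx).f k = ofElement x :=
    (Iso.inv_comp_eq _).2 (HomologicalComplex.mkHomFromSingle_f ..)
  exact (ConcreteCategory.congr_hom h (1 : ℚ)).trans (ofElement_apply_one x)

lemma sphere_hom_ext {X : Ch} {k : ℕ} {f g : sphere k ⟶ X}
    (h : f.f k (sphereGen k) = g.f k (sphereGen k)) : f = g := by
  refine HomologicalComplex.from_single_hom_ext ?_
  rw [← cancel_epi (HomologicalComplex.singleObjXSelf (ComplexShape.up ℕ) k Q).inv]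
  exact Q_hom_ext h

/-- This makes a square from `S^{k+1} ⟶ D^{k+1}` to `f` a cocycle `z` together with `y` such that `d
y = f z`. -/
lemma sphereToDisk_gen (k : ℕ) :
    (sphereToDisk (k + 1)).f (k + 1) (sphereGen (k + 1)) =
      (disk (k + 1)).d k (k + 1) (diskGen k) := by
  have h : (HomologicalComplex.singleObjXSelf (ComplexShape.up ℕ) (k + 1) Q).inv ≫
      (sphereToDisk (k + 1)).f (k + 1) =
      (HomologicalComplex.doubleXIso₀ (c := ComplexShape.up ℕ) (𝟙 Q) (i₀ := k) (i₁ := k + 1)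
        rfl).inv ≫ (disk (k + 1)).d k (k + 1) := by
    have h₁ : (sphereToDisk (k + 1)).f (k + 1) =
        (HomologicalComplex.singleObjXSelf (ComplexShape.up ℕ) (k + 1) Q).hom ≫
          (HomologicalComplex.doubleXIso₁ (c := ComplexShape.up ℕ) (𝟙 Q) (i₀ := k) rfl
            (by simp)).inv := by
      rw [sphereToDisk]
      exact HomologicalComplex.mkHomFromSingle_f _ _
    have h₂ : (disk (k + 1)).d k (k + 1) = _ := HomologicalComplex.double_d
      (c := ComplexShape.up ℕ) (𝟙 Q) (i₀ := k) (i₁ := k + 1) rfl (by simp)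
    refine ((Iso.inv_comp_eq _).2 h₁).trans ((Iso.eq_inv_comp _).2 (Eq.trans ?_ h₂.symm))
    rw [Category.id_comp]
  exact ConcreteCategory.congr_hom h (1 : ℚ)

lemma hom_f_d_apply {X Y : Ch} (f : X ⟶ Y) (i j : ℕ) (x : X.X i) :
    f.f j (X.d i j x) = Y.d i j (f.f i x) :=
  (ConcreteCategory.congr_hom (f.comm i j) x).symm

lemma d_d_apply (X : Ch) (i j k : ℕ) (x : X.X i) : X.d j k (X.d i j x) = 0 :=
  ConcreteCategory.congr_hom (X.d_comp_d i j k) x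

-- Local presentability of persistent complexes

attribute [local instance] Cardinal.fact_isRegular_aleph0

/-- `Hom(ℚ, -)` is the forgetful functor, which preserves filtered colimits. -/
instance isFinitelyPresentable_Q : IsCardinalPresentable Q Cardinal.aleph0.{0} := by
  let e : coyoneda.obj (Opposite.op Q) ≅ forget (ModuleCat.{0} ℚ) :=
    NatIso.ofComponents (fun M ↦ Equiv.toIso
      { toFun (f : Q ⟶ M) := f.hom (1 : ℚ)
        invFun x := ofElement x
        left_inv f := Q_hom_ext (ofElement_apply_one _)
        right_inv x := ofElement_apply_one x })
  constructor
  intro J _ _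
  have := isFiltered_of_isCardinalFiltered J Cardinal.aleph0.{0}
  exact preservesColimitsOfShape_of_natIso e.symm

/-- The disks `D^{k+1}` detect elements in every degree, so they form a strong generator; they are
finitely presentable because `ℚ` is. -/
instance isLocallyPresentable_Ch : IsLocallyPresentable.{0} Ch := by
  refine ⟨Cardinal.aleph0, inferInstance, ?_⟩
  rw [IsCardinalLocallyPresentable.iff_exists_isStrongGenerator]
  let D (k : ℕ) : Ch := disk (k + 1)
  refine ⟨.ofObj D, inferInstance, ?_, ?_⟩
  · rw [ObjectProperty.isStrongGenerator_iff]
    refine ⟨?_, fun X Y i _ hi ↦ ?_⟩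
    · intro K L f g h
      ext k x
      have := ConcreteCategory.congr_hom
        (HomologicalComplex.congr_hom (h _ ⟨k⟩ (diskDesc x)) k) (diskGen k)
      change f.f k ((diskDesc x).f k _) = g.f k ((diskDesc x).f k _) at this
      rwa [diskDesc_gen] at this
    · have (k : ℕ) : IsIso (i.f k) := by
        rw [ConcreteCategory.isIso_iff_bijective]
        refine ⟨(ModuleCat.mono_iff_injective _).1 inferInstance, fun y ↦ ?_⟩
        obtain ⟨φ, hφ⟩ := hi _ ⟨k⟩ (diskDesc y)
        refine ⟨φ.f k (diskGen k), ?_⟩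
        exact (ConcreteCategory.congr_hom (HomologicalComplex.congr_hom hφ k) (diskGen k)).trans
          (diskDesc_gen y)
      exact HomologicalComplex.Hom.isIso_of_components i
  · rintro _ ⟨k⟩
    rw [isCardinalPresentable_iff]
    constructor
    intro J _ _
    have := preservesColimitsOfShape_of_isCardinalPresentable Q Cardinal.aleph0.{0} J
    have := isFiltered_of_isCardinalFiltered J Cardinal.aleph0.{0}
    let e : HomologicalComplex.eval _ _ k ⋙ coyoneda.obj (Opposite.op Q) ≅
        coyoneda.obj (Opposite.op (D k)) :=
      (HomologicalComplex.evalCompCoyonedaCorepresentableByDoubleId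
        (c := .up ℕ) (i₀ := k) (i₁ := k + 1) rfl (by simp) Q).toIso.symm
    exact preservesColimitsOfShape_of_natIso e

instance isLocallyPresentable_PCh : IsLocallyPresentable.{0} PCh :=
  ((opOpEquivalence ℝ≥0).congrLeft (E := Ch)).isLocallyPresentable

instance isSmall_sup {C : Type u} [Category.{v} C] (W W' : MorphismProperty C)
    [MorphismProperty.IsSmall.{0} W] [MorphismProperty.IsSmall.{0} W'] :
    MorphismProperty.IsSmall.{0} (W ⊔ W') := by
  rw [sup_eq_iSup]
  have (b : Bool) : MorphismProperty.IsSmall.{0} (bif b then W else W') := by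
    cases b <;> assumption
  infer_instance

instance isSmall_setI : MorphismProperty.IsSmall.{0} setI :=
  isSmall_sup _ _

instance isSmall_setJ : MorphismProperty.IsSmall.{0} setJ :=
  isSmall_sup _ _

instance hasSmallObjectArgument_setI : MorphismProperty.HasSmallObjectArgument.{0} setI :=
  setI.hasSmallObjectArgument_of_isLocallyPresentable

instance hasSmallObjectArgument_setJ : MorphismProperty.HasSmallObjectArgument.{0} setJ :=
  setJ.hasSmallObjectArgument_of_isLocallyPresentable

/-! ### Generators of persistent disks and interval spheres -/

lemma comp_f_apply {X Y Z : Ch} (f : X ⟶ Y) (g : Y ⟶ Z) (k : ℕ) (x : X.X k) :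
    (f ≫ g).f k x = g.f k (f.f k x) := rfl

lemma comp_app_f_apply {X Y Z : PCh} (f : X ⟶ Y) (g : Y ⟶ Z) (s : ℝ≥0) (k : ℕ)
    (x : (X.obj s).X k) : ((f ≫ g).app s).f k x = (g.app s).f k ((f.app s).f k x) := rfl

lemma app_f_map_apply {X Y : PCh} (f : X ⟶ Y) {s t : ℝ≥0} (h : s ⟶ t) (k : ℕ)
    (x : (X.obj s).X k) :
    (f.app t).f k ((X.map h).f k x) = (Y.map h).f k ((f.app s).f k x) :=
  ConcreteCategory.congr_hom (HomologicalComplex.congr_hom (f.naturality h) k) x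

@[simp]
lemma extendPointUnit_desc {s : ℝ≥0} {K : Ch} {X : PCh} (φ : K ⟶ X.obj s) :
    extendPointUnit s K ≫ (extendPointDesc φ).app s = φ :=
  Functor.descOfIsLeftKanExtension_fac_app ((pointInclusion s).leftKanExtension _)
    ((pointInclusion s).leftKanExtensionUnit (Functor.fromPUnit K)) X { app := fun _ => φ } ⟨⟨⟩⟩

lemma extendPoint_hom_ext {s : ℝ≥0} {K : Ch} {X : PCh} {f g : extendPoint s K ⟶ X}
    (h : extendPointUnit s K ≫ f.app s = extendPointUnit s K ≫ g.app s) : f = g := by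
  refine Functor.hom_ext_of_isLeftKanExtension _
    ((pointInclusion s).leftKanExtensionUnit (Functor.fromPUnit K)) _ _ ?_
  ext ⟨⟨⟩⟩ : 2
  exact h

/-- The unit `D^k ⟶ 𝔻^k_s(s)`. -/
def persistentDiskUnit (k : ℕ) (s : ℝ≥0) : disk k ⟶ (persistentDisk k s).obj s :=
  extendPointUnit s (disk k)

/-- The generator of the persistent disk `𝔻^{k+1}_s`, in degree `k` at time `s`. -/
def persistentDiskGen (k : ℕ) (s : ℝ≥0) : ((persistentDisk (k + 1) s).obj s).X k :=
  (persistentDiskUnit (k + 1) s).f k (diskGen k)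

/-- The morphism `𝔻^{k+1}_s ⟶ X` that corresponds to an element of degree `k` of `X(s)`. -/
def persistentDiskDesc {X : PCh} {k : ℕ} {s : ℝ≥0} (x : (X.obj s).X k) :
    persistentDisk (k + 1) s ⟶ X :=
  extendPointDesc (diskDesc x)

@[simp]
lemma persistentDiskDesc_gen {X : PCh} {k : ℕ} {s : ℝ≥0} (x : (X.obj s).X k) :
    ((persistentDiskDesc x).app s).f k (persistentDiskGen k s) = x :=
  (ConcreteCategory.congr_hom (HomologicalComplex.congr_hom
    (extendPointUnit_desc (diskDesc x)) k) (diskGen k)).trans (diskDesc_gen x)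

lemma persistentDisk_hom_ext {X : PCh} {k : ℕ} {s : ℝ≥0} {f g : persistentDisk (k + 1) s ⟶ X}
    (h : (f.app s).f k (persistentDiskGen k s) = (g.app s).f k (persistentDiskGen k s)) :
    f = g :=
  extendPoint_hom_ext (disk_hom_ext h)

lemma isZero_disk_zero : IsZero (disk 0) := isZero_zero _

/-- For `k = 0` a lift can only be zero, so lifting against `𝕊^0 ⟶ 𝔻^0` is a vanishing statement. -/
lemma isZero_persistentDisk_zero (s : ℝ≥0) : IsZero (persistentDisk 0 s) := by
  rw [IsZero.iff_id_eq_zero]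
  exact extendPoint_hom_ext (isZero_disk_zero.eq_of_src _ _)

lemma diskToDisk_gen (k : ℕ) {s t : ℝ≥0} (h : s < t) :
    ((diskToDisk (k + 1) h).app t).f k (persistentDiskGen k t) =
      ((persistentDisk (k + 1) s).map (homOfLE h.le)).f k (persistentDiskGen k s) :=
  ConcreteCategory.congr_hom (HomologicalComplex.congr_hom
    (extendPointUnit_desc (X := persistentDisk (k + 1) s) _) k) (diskGen k)

/-- The generator of the interval sphere `𝕊^k_{[s,∞)}`. -/
def intervalSphereInftyGen (k : ℕ) (s : ℝ≥0) : ((intervalSphereInfty k s).obj s).X k :=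
  (extendPointUnit s (sphere k)).f k (sphereGen k)

lemma d_intervalSphereInftyGen (k : ℕ) (s : ℝ≥0) (j : ℕ) :
    ((intervalSphereInfty k s).obj s).d k j (intervalSphereInftyGen k s) = 0 := by
  rw [intervalSphereInftyGen]
  refine (hom_f_d_apply (extendPointUnit s (sphere k)) k j (sphereGen k)).symm.trans ?_
  rw [d_sphereGen, map_zero]
  rfl

lemma intervalSphereInfty_hom_ext {X : PCh} {k : ℕ} {s : ℝ≥0}
    {f g : intervalSphereInfty k s ⟶ X}
    (h : (f.app s).f k (intervalSphereInftyGen k s) =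
      (g.app s).f k (intervalSphereInftyGen k s)) : f = g :=
  extendPoint_hom_ext (sphere_hom_ext h)

/-- The morphism `𝕊^k_{[s,∞)} ⟶ X` that corresponds to a cocycle of `X(s)`. -/
def intervalSphereInftyDesc {X : PCh} {k : ℕ} {s : ℝ≥0} (z : (X.obj s).X k)
    (hz : (X.obj s).d k (k + 1) z = 0) : intervalSphereInfty k s ⟶ X :=
  extendPointDesc (sphereDesc z hz)

@[simp]
lemma intervalSphereInftyDesc_gen {X : PCh} {k : ℕ} {s : ℝ≥0} (z : (X.obj s).X k)
    (hz : (X.obj s).d k (k + 1) z = 0) :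
    ((intervalSphereInftyDesc z hz).app s).f k (intervalSphereInftyGen k s) = z :=
  (ConcreteCategory.congr_hom (HomologicalComplex.congr_hom
    (extendPointUnit_desc (sphereDesc z hz)) k) (sphereGen k)).trans (sphereDesc_gen z hz)

lemma intervalSphereInftyToDisk_gen (k : ℕ) (s : ℝ≥0) :
    ((intervalSphereInftyToDisk (k + 1) s).app s).f (k + 1) (intervalSphereInftyGen (k + 1) s) =
      ((persistentDisk (k + 1) s).obj s).d k (k + 1) (persistentDiskGen k s) := by
  refine (ConcreteCategory.congr_hom (HomologicalComplex.congr_hom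
    (extendPointUnit_desc (X := persistentDisk (k + 1) s) _) (k + 1))
      (sphereGen (k + 1))).trans ?_
  exact (congrArg ((persistentDiskUnit (k + 1) s).f (k + 1)) (sphereToDisk_gen k)).trans
    (hom_f_d_apply ..)

section

variable (k : ℕ) {s t : ℝ≥0} (h : s < t)

/-- The component at time `s` of the unit of the left Kan extension `𝕊^k_{[s,t)}`. -/
def intervalSphereUnit₀ : sphere k ⟶ (intervalSphere k h).obj s :=
  ((pairInclusion h).leftKanExtensionUnit (ComposableArrows.mk₁ (sphereToDisk k))).app 0

/-- The component at time `t` of the unit of the left Kan extension `𝕊^k_{[s,t)}`. -/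
def intervalSphereUnit₁ : disk k ⟶ (intervalSphere k h).obj t :=
  ((pairInclusion h).leftKanExtensionUnit (ComposableArrows.mk₁ (sphereToDisk k))).app 1

lemma intervalSphereUnit_naturality :
    sphereToDisk k ≫ intervalSphereUnit₁ k h =
      intervalSphereUnit₀ k h ≫ (intervalSphere k h).map (homOfLE h.le) :=
  ((pairInclusion h).leftKanExtensionUnit
    (ComposableArrows.mk₁ (sphereToDisk k))).naturality (homOfLE (by decide) : (0 : Fin 2) ⟶ 1)

variable {k h}

lemma intervalSphere_hom_ext' {X : PCh} {f g : intervalSphere k h ⟶ X}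
    (h₀ : intervalSphereUnit₀ k h ≫ f.app s = intervalSphereUnit₀ k h ≫ g.app s)
    (h₁ : intervalSphereUnit₁ k h ≫ f.app t = intervalSphereUnit₁ k h ≫ g.app t) : f = g := by
  refine Functor.hom_ext_of_isLeftKanExtension _
    ((pairInclusion h).leftKanExtensionUnit (ComposableArrows.mk₁ (sphereToDisk k))) _ _ ?_
  exact ComposableArrows.hom_ext₁ h₀ h₁

/-- The morphism `𝕊^k_{[s,t)} ⟶ X` that corresponds to a morphism of arrows from
`S^k ⟶ D^k` to `X(s) ⟶ X(t)`. -/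
def intervalSphereDesc' {X : PCh} (φ₀ : sphere k ⟶ X.obj s) (φ₁ : disk k ⟶ X.obj t)
    (w : sphereToDisk k ≫ φ₁ = φ₀ ≫ X.map (homOfLE h.le)) : intervalSphere k h ⟶ X :=
  ((pairInclusion h).leftKanExtension
      (ComposableArrows.mk₁ (sphereToDisk k))).descOfIsLeftKanExtension
    ((pairInclusion h).leftKanExtensionUnit (ComposableArrows.mk₁ (sphereToDisk k))) X
    (ComposableArrows.homMk₁ φ₀ φ₁ w)

lemma intervalSphereUnit₀_desc' {X : PCh} (φ₀ : sphere k ⟶ X.obj s) (φ₁ : disk k ⟶ X.obj t)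
    (w : sphereToDisk k ≫ φ₁ = φ₀ ≫ X.map (homOfLE h.le)) :
    intervalSphereUnit₀ k h ≫ (intervalSphereDesc' φ₀ φ₁ w).app s = φ₀ :=
  Functor.descOfIsLeftKanExtension_fac_app ((pairInclusion h).leftKanExtension _)
    ((pairInclusion h).leftKanExtensionUnit (ComposableArrows.mk₁ (sphereToDisk k))) X
    (ComposableArrows.homMk₁ φ₀ φ₁ w) 0

lemma intervalSphereUnit₁_desc' {X : PCh} (φ₀ : sphere k ⟶ X.obj s) (φ₁ : disk k ⟶ X.obj t)
    (w : sphereToDisk k ≫ φ₁ = φ₀ ≫ X.map (homOfLE h.le)) :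
    intervalSphereUnit₁ k h ≫ (intervalSphereDesc' φ₀ φ₁ w).app t = φ₁ :=
  Functor.descOfIsLeftKanExtension_fac_app ((pairInclusion h).leftKanExtension _)
    ((pairInclusion h).leftKanExtensionUnit (ComposableArrows.mk₁ (sphereToDisk k))) X
    (ComposableArrows.homMk₁ φ₀ φ₁ w) 1

lemma intervalSphereUnit₀_toDisk :
    intervalSphereUnit₀ k h ≫ (intervalSphereToDisk k h).app s =
      sphereToDisk k ≫ persistentDiskUnit k s :=
  intervalSphereUnit₀_desc' (X := persistentDisk k s) _ _ _

lemma intervalSphereUnit₁_toDisk :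
    intervalSphereUnit₁ k h ≫ (intervalSphereToDisk k h).app t =
      persistentDiskUnit k s ≫ (persistentDisk k s).map (homOfLE h.le) :=
  intervalSphereUnit₁_desc' (X := persistentDisk k s) _ _ _

end

section

variable (k : ℕ) {s t : ℝ≥0} (h : s < t)

/-- The generator of degree `k` of the interval sphere `𝕊^k_{[s,t)}`. -/
def intervalSphereGen₀ : ((intervalSphere k h).obj s).X k :=
  (intervalSphereUnit₀ k h).f k (sphereGen k)

/-- The generator of degree `k` of the interval sphere `𝕊^{k+1}_{[s,t)}`. -/
def intervalSphereGen₁ : ((intervalSphere (k + 1) h).obj t).X k :=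
  (intervalSphereUnit₁ (k + 1) h).f k (diskGen k)

lemma d_intervalSphereGen₀ (j : ℕ) :
    ((intervalSphere k h).obj s).d k j (intervalSphereGen₀ k h) = 0 := by
  rw [intervalSphereGen₀, ← hom_f_d_apply, d_sphereGen, map_zero]

lemma d_intervalSphereGen₁ :
    ((intervalSphere (k + 1) h).obj t).d k (k + 1) (intervalSphereGen₁ k h) =
      ((intervalSphere (k + 1) h).map (homOfLE h.le)).f (k + 1)
        (intervalSphereGen₀ (k + 1) h) := by
  rw [intervalSphereGen₁, ← hom_f_d_apply, ← sphereToDisk_gen, ← comp_f_apply,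
    intervalSphereUnit_naturality]
  rfl

lemma intervalSphereToDisk_gen₀ :
    ((intervalSphereToDisk (k + 1) h).app s).f (k + 1) (intervalSphereGen₀ (k + 1) h) =
      ((persistentDisk (k + 1) s).obj s).d k (k + 1) (persistentDiskGen k s) := by
  rw [intervalSphereGen₀, ← comp_f_apply, intervalSphereUnit₀_toDisk, comp_f_apply,
    sphereToDisk_gen, hom_f_d_apply]
  rfl

lemma intervalSphereToDisk_gen₁ :
    ((intervalSphereToDisk (k + 1) h).app t).f k (intervalSphereGen₁ k h) =
      ((persistentDisk (k + 1) s).map (homOfLE h.le)).f k (persistentDiskGen k s) := by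
  rw [intervalSphereGen₁, ← comp_f_apply, intervalSphereUnit₁_toDisk, comp_f_apply]
  rfl

variable {k h} {X : PCh}

lemma intervalSphere_hom_ext {f g : intervalSphere (k + 1) h ⟶ X}
    (h₀ : (f.app s).f (k + 1) (intervalSphereGen₀ (k + 1) h) =
      (g.app s).f (k + 1) (intervalSphereGen₀ (k + 1) h))
    (h₁ : (f.app t).f k (intervalSphereGen₁ k h) = (g.app t).f k (intervalSphereGen₁ k h)) :
    f = g :=
  intervalSphere_hom_ext' (sphere_hom_ext h₀) (disk_hom_ext h₁)

lemma intervalSphere_zero_hom_ext {f g : intervalSphere 0 h ⟶ X}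
    (h₀ : (f.app s).f 0 (intervalSphereGen₀ 0 h) = (g.app s).f 0 (intervalSphereGen₀ 0 h)) :
    f = g :=
  intervalSphere_hom_ext' (sphere_hom_ext h₀) (isZero_disk_zero.eq_of_src _ _)

/-- The morphism `𝕊^{k+1}_{[s,t)} ⟶ X` that corresponds to a cocycle of `X(s)` and a cochain
of `X(t)` whose differential is the restriction of the cocycle. -/
def intervalSphereDesc (z : (X.obj s).X (k + 1)) (x : (X.obj t).X k)
    (hz : (X.obj s).d (k + 1) (k + 2) z = 0)
    (hx : (X.obj t).d k (k + 1) x = (X.map (homOfLE h.le)).f (k + 1) z) :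
    intervalSphere (k + 1) h ⟶ X :=
  intervalSphereDesc' (sphereDesc z hz) (diskDesc x) (sphere_hom_ext (by
    rw [comp_f_apply, comp_f_apply, sphereToDisk_gen, sphereDesc_gen, ← hx, hom_f_d_apply,
      diskDesc_gen]))

@[simp]
lemma intervalSphereDesc_gen₀ (z : (X.obj s).X (k + 1)) (x : (X.obj t).X k)
    (hz : (X.obj s).d (k + 1) (k + 2) z = 0)
    (hx : (X.obj t).d k (k + 1) x = (X.map (homOfLE h.le)).f (k + 1) z) :
    ((intervalSphereDesc z x hz hx).app s).f (k + 1) (intervalSphereGen₀ (k + 1) h) = z := by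
  rw [intervalSphereGen₀, ← comp_f_apply, intervalSphereDesc, intervalSphereUnit₀_desc',
    sphereDesc_gen]

@[simp]
lemma intervalSphereDesc_gen₁ (z : (X.obj s).X (k + 1)) (x : (X.obj t).X k)
    (hz : (X.obj s).d (k + 1) (k + 2) z = 0)
    (hx : (X.obj t).d k (k + 1) x = (X.map (homOfLE h.le)).f (k + 1) z) :
    ((intervalSphereDesc z x hz hx).app t).f k (intervalSphereGen₁ k h) = x := by
  rw [intervalSphereGen₁, ← comp_f_apply, intervalSphereDesc, intervalSphereUnit₁_desc',
    diskDesc_gen]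

end

/-! ### Lifting against `𝕁` and `𝕀` in terms of elements -/

/-- The elementwise description of the maps with the right lifting property against `𝕁`:
`X(s) ⟶ Y(s)` and `X(s) ⟶ Y(s) ×_{Y(t)} X(t)` are surjective in each degree. -/
structure IsDegreewiseFibration {X Y : PCh} (f : X ⟶ Y) : Prop where
  surjective (s : ℝ≥0) (k : ℕ) : Function.Surjective ((f.app s).f k)
  exists_lift {s t : ℝ≥0} (h : s < t) (k : ℕ) (y : (Y.obj s).X k) (x : (X.obj t).X k)
    (hxy : (f.app t).f k x = (Y.map (homOfLE h.le)).f k y) :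
    ∃ x' : (X.obj s).X k, (f.app s).f k x' = y ∧ (X.map (homOfLE h.le)).f k x' = x

/-- The elementwise description of the maps with the right lifting property against `𝕀`. -/
structure IsDegreewiseTrivialFibration {X Y : PCh} (f : X ⟶ Y) : Prop where
  eq_zero (s : ℝ≥0) (z : (X.obj s).X 0) (hz : (X.obj s).d 0 1 z = 0)
    (hfz : (f.app s).f 0 z = 0) : z = 0
  exists_primitive (s : ℝ≥0) (k : ℕ) (z : (X.obj s).X (k + 1)) (y : (Y.obj s).X k)
    (hz : (X.obj s).d (k + 1) (k + 2) z = 0)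
    (hy : (Y.obj s).d k (k + 1) y = (f.app s).f (k + 1) z) :
    ∃ x : (X.obj s).X k, (X.obj s).d k (k + 1) x = z ∧ (f.app s).f k x = y
  exists_lift {s t : ℝ≥0} (h : s < t) (k : ℕ) (z : (X.obj s).X (k + 1)) (y : (Y.obj s).X k)
    (x : (X.obj t).X k) (hz : (X.obj s).d (k + 1) (k + 2) z = 0)
    (hy : (Y.obj s).d k (k + 1) y = (f.app s).f (k + 1) z)
    (hx : (X.obj t).d k (k + 1) x = (X.map (homOfLE h.le)).f (k + 1) z)
    (hxy : (f.app t).f k x = (Y.map (homOfLE h.le)).f k y) :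
    ∃ x' : (X.obj s).X k, (X.obj s).d k (k + 1) x' = z ∧ (f.app s).f k x' = y ∧
      (X.map (homOfLE h.le)).f k x' = x

section

variable (k : ℕ) {s t : ℝ≥0} (h : s < t)

lemma diskToDisk_mem_setJ : setJ (diskToDisk k h) :=
  Or.inl (MorphismProperty.ofHoms.mk
    (f := fun i : ℕ × { p : ℝ≥0 × ℝ≥0 // p.1 < p.2 } ↦ diskToDisk i.1 i.2.2) (k, ⟨(s, t), h⟩))

lemma zero_persistentDisk_mem_setJ (s : ℝ≥0) :
    setJ (0 : (0 : PCh) ⟶ persistentDisk k s) :=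
  Or.inr (MorphismProperty.ofHoms.mk
    (f := fun i : ℕ × ℝ≥0 ↦ (0 : (0 : PCh) ⟶ persistentDisk i.1 i.2)) (k, s))

lemma intervalSphereToDisk_mem_setI : setI (intervalSphereToDisk k h) :=
  Or.inl (MorphismProperty.ofHoms.mk
    (f := fun i : ℕ × { p : ℝ≥0 × ℝ≥0 // p.1 < p.2 } ↦ intervalSphereToDisk i.1 i.2.2)
      (k, ⟨(s, t), h⟩))

lemma intervalSphereInftyToDisk_mem_setI (s : ℝ≥0) : setI (intervalSphereInftyToDisk k s) :=
  Or.inr (MorphismProperty.ofHoms.mk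
    (f := fun i : ℕ × ℝ≥0 ↦ intervalSphereInftyToDisk i.1 i.2) (k, s))

end

section

variable {X Y : PCh} (f : X ⟶ Y)

lemma hasLiftingProperty_zero_persistentDisk_iff (k : ℕ) (s : ℝ≥0) :
    HasLiftingProperty (0 : (0 : PCh) ⟶ persistentDisk (k + 1) s) f ↔
      Function.Surjective ((f.app s).f k) := by
  refine ⟨fun hf y ↦ ?_, fun hf ↦ ⟨fun {u v} sq ↦ ?_⟩⟩
  · have sq : CommSq 0 (0 : (0 : PCh) ⟶ persistentDisk (k + 1) s) f (persistentDiskDesc y) :=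
      ⟨by simp⟩
    refine ⟨(sq.lift.app s).f k (persistentDiskGen k s), ?_⟩
    rw [← comp_app_f_apply, sq.fac_right, persistentDiskDesc_gen]
  · obtain ⟨x, hx⟩ := hf ((v.app s).f k (persistentDiskGen k s))
    refine ⟨⟨persistentDiskDesc x, (isZero_zero _).eq_of_src _ _, persistentDisk_hom_ext ?_⟩⟩
    rw [comp_app_f_apply, persistentDiskDesc_gen, hx]

lemma hasLiftingProperty_diskToDisk_iff (k : ℕ) {s t : ℝ≥0} (h : s < t) :
    HasLiftingProperty (diskToDisk (k + 1) h) f ↔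
      ∀ (y : (Y.obj s).X k) (x : (X.obj t).X k)
        (_ : (f.app t).f k x = (Y.map (homOfLE h.le)).f k y),
        ∃ x' : (X.obj s).X k, (f.app s).f k x' = y ∧ (X.map (homOfLE h.le)).f k x' = x := by
  refine ⟨fun hf y x hxy ↦ ?_, fun hf ↦ ⟨fun {u v} sq ↦ ?_⟩⟩
  · have sq : CommSq (persistentDiskDesc x) (diskToDisk (k + 1) h) f (persistentDiskDesc y) :=
      ⟨persistentDisk_hom_ext (by
        rw [comp_app_f_apply, comp_app_f_apply, diskToDisk_gen, app_f_map_apply,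
          persistentDiskDesc_gen, persistentDiskDesc_gen, hxy])⟩
    refine ⟨(sq.lift.app s).f k (persistentDiskGen k s), ?_, ?_⟩
    · rw [← comp_app_f_apply, sq.fac_right, persistentDiskDesc_gen]
    · rw [← app_f_map_apply, ← diskToDisk_gen k h, ← comp_app_f_apply, sq.fac_left,
        persistentDiskDesc_gen]
  · obtain ⟨x', hx₁, hx₂⟩ := hf ((v.app s).f k (persistentDiskGen k s))
      ((u.app t).f k (persistentDiskGen k t)) (by
        rw [← comp_app_f_apply, sq.w, comp_app_f_apply, diskToDisk_gen, app_f_map_apply])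
    refine ⟨⟨persistentDiskDesc x', persistentDisk_hom_ext ?_, persistentDisk_hom_ext ?_⟩⟩
    · rw [comp_app_f_apply, diskToDisk_gen, app_f_map_apply, persistentDiskDesc_gen, hx₂]
    · rw [comp_app_f_apply, persistentDiskDesc_gen, hx₁]

lemma setJ_rlp_iff : setJ.rlp f ↔ IsDegreewiseFibration f := by
  constructor
  · intro hf
    exact
      { surjective s k := (hasLiftingProperty_zero_persistentDisk_iff f k s).1
          (hf _ (zero_persistentDisk_mem_setJ _ _))
        exists_lift h k := (hasLiftingProperty_diskToDisk_iff f k h).1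
          (hf _ (diskToDisk_mem_setJ _ h)) }
  · rintro hf _ _ _ (⟨⟨k, ⟨s, t⟩, h⟩⟩ | ⟨⟨k, s⟩⟩)
    -- For `k = 0` the generators are isomorphisms between zero objects and impose no condition.
    · cases k with
      | zero =>
        have : IsIso (diskToDisk 0 h) :=
          isIso_of_source_target_iso_zero _ (isZero_persistentDisk_zero t).isoZero
            (isZero_persistentDisk_zero s).isoZero
        infer_instance
      | succ k => exact (hasLiftingProperty_diskToDisk_iff f k h).2 (hf.exists_lift h k)
    · cases k with
      | zero =>
        have : IsIso (0 : (0 : PCh) ⟶ persistentDisk 0 s) :=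
          isIso_of_source_target_iso_zero _ (Iso.refl _)
            (isZero_persistentDisk_zero s).isoZero
        infer_instance
      | succ k => exact (hasLiftingProperty_zero_persistentDisk_iff f k s).2 (hf.surjective s k)

lemma hasLiftingProperty_intervalSphereInftyToDisk_succ_iff (k : ℕ) (s : ℝ≥0) :
    HasLiftingProperty (intervalSphereInftyToDisk (k + 1) s) f ↔
      ∀ (z : (X.obj s).X (k + 1)) (y : (Y.obj s).X k)
        (_ : (X.obj s).d (k + 1) (k + 2) z = 0)
        (_ : (Y.obj s).d k (k + 1) y = (f.app s).f (k + 1) z),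
        ∃ x : (X.obj s).X k, (X.obj s).d k (k + 1) x = z ∧ (f.app s).f k x = y := by
  refine ⟨fun hf z y hz hy ↦ ?_, fun hf ↦ ⟨fun {u v} sq ↦ ?_⟩⟩
  · have sq : CommSq (intervalSphereInftyDesc z hz) (intervalSphereInftyToDisk (k + 1) s) f
        (persistentDiskDesc y) :=
      ⟨intervalSphereInfty_hom_ext (by
        rw [comp_app_f_apply, comp_app_f_apply, intervalSphereInftyToDisk_gen, hom_f_d_apply,
          persistentDiskDesc_gen, intervalSphereInftyDesc_gen, hy])⟩
    refine ⟨(sq.lift.app s).f k (persistentDiskGen k s), ?_, ?_⟩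
    · rw [← hom_f_d_apply, ← intervalSphereInftyToDisk_gen, ← comp_app_f_apply, sq.fac_left,
        intervalSphereInftyDesc_gen]
    · rw [← comp_app_f_apply, sq.fac_right, persistentDiskDesc_gen]
  · obtain ⟨x, hx₁, hx₂⟩ := hf ((u.app s).f (k + 1) (intervalSphereInftyGen (k + 1) s))
      ((v.app s).f k (persistentDiskGen k s))
      (by rw [← hom_f_d_apply, d_intervalSphereInftyGen, map_zero])
      (by rw [← comp_app_f_apply, sq.w, comp_app_f_apply, intervalSphereInftyToDisk_gen,
        hom_f_d_apply])
    refine ⟨⟨persistentDiskDesc x, intervalSphereInfty_hom_ext ?_, persistentDisk_hom_ext ?_⟩⟩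
    · rw [comp_app_f_apply, intervalSphereInftyToDisk_gen, hom_f_d_apply,
        persistentDiskDesc_gen, hx₁]
    · rw [comp_app_f_apply, persistentDiskDesc_gen, hx₂]

lemma hasLiftingProperty_intervalSphereInftyToDisk_zero_iff (s : ℝ≥0) :
    HasLiftingProperty (intervalSphereInftyToDisk 0 s) f ↔
      ∀ (z : (X.obj s).X 0) (_ : (X.obj s).d 0 1 z = 0) (_ : (f.app s).f 0 z = 0), z = 0 := by
  refine ⟨fun hf z hz hfz ↦ ?_, fun hf ↦ ⟨fun {u v} sq ↦ ?_⟩⟩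
  · have sq : CommSq (intervalSphereInftyDesc z hz) (intervalSphereInftyToDisk 0 s) f 0 :=
      ⟨intervalSphereInfty_hom_ext (by
        rw [comp_app_f_apply, intervalSphereInftyDesc_gen, hfz, comp_zero]
        rfl)⟩
    have h : intervalSphereInftyDesc z hz = 0 := by
      rw [← sq.fac_left, (isZero_persistentDisk_zero s).eq_of_src sq.lift 0, comp_zero]
    rw [← intervalSphereInftyDesc_gen z hz, h]
    rfl
  · have hv : v = 0 := (isZero_persistentDisk_zero s).eq_of_src _ _
    have hu : u = 0 := intervalSphereInfty_hom_ext (hf _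
      (by rw [← hom_f_d_apply, d_intervalSphereInftyGen, map_zero])
      (by
        rw [← comp_app_f_apply, sq.w, hv, comp_zero]
        rfl))
    exact ⟨⟨0, by rw [comp_zero, hu], by rw [zero_comp, hv]⟩⟩

lemma hasLiftingProperty_intervalSphereToDisk_succ_iff (k : ℕ) {s t : ℝ≥0} (h : s < t) :
    HasLiftingProperty (intervalSphereToDisk (k + 1) h) f ↔
      ∀ (z : (X.obj s).X (k + 1)) (y : (Y.obj s).X k)
        (x : (X.obj t).X k) (_ : (X.obj s).d (k + 1) (k + 2) z = 0)
        (_ : (Y.obj s).d k (k + 1) y = (f.app s).f (k + 1) z)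
        (_ : (X.obj t).d k (k + 1) x = (X.map (homOfLE h.le)).f (k + 1) z)
        (_ : (f.app t).f k x = (Y.map (homOfLE h.le)).f k y),
        ∃ x' : (X.obj s).X k, (X.obj s).d k (k + 1) x' = z ∧ (f.app s).f k x' = y ∧
          (X.map (homOfLE h.le)).f k x' = x := by
  refine ⟨fun hf z y x hz hy hx hxy ↦ ?_, fun hf ↦ ⟨fun {u v} sq ↦ ?_⟩⟩
  · have sq : CommSq (intervalSphereDesc z x hz hx) (intervalSphereToDisk (k + 1) h) f
        (persistentDiskDesc y) :=
      ⟨intervalSphere_hom_ext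
        (by rw [comp_app_f_apply, comp_app_f_apply, intervalSphereToDisk_gen₀, hom_f_d_apply,
          persistentDiskDesc_gen, intervalSphereDesc_gen₀, hy])
        (by rw [comp_app_f_apply, comp_app_f_apply, intervalSphereToDisk_gen₁, app_f_map_apply,
          persistentDiskDesc_gen, intervalSphereDesc_gen₁, hxy])⟩
    refine ⟨(sq.lift.app s).f k (persistentDiskGen k s), ?_, ?_, ?_⟩
    · rw [← hom_f_d_apply, ← intervalSphereToDisk_gen₀ k h, ← comp_app_f_apply, sq.fac_left,
        intervalSphereDesc_gen₀]
    · rw [← comp_app_f_apply, sq.fac_right, persistentDiskDesc_gen]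
    · rw [← app_f_map_apply, ← intervalSphereToDisk_gen₁ k h, ← comp_app_f_apply, sq.fac_left,
        intervalSphereDesc_gen₁]
  · obtain ⟨x, hx₁, hx₂, hx₃⟩ := hf ((u.app s).f (k + 1) (intervalSphereGen₀ (k + 1) h))
      ((v.app s).f k (persistentDiskGen k s)) ((u.app t).f k (intervalSphereGen₁ k h))
      (by rw [← hom_f_d_apply, d_intervalSphereGen₀, map_zero])
      (by rw [← comp_app_f_apply, sq.w, comp_app_f_apply, intervalSphereToDisk_gen₀,
        hom_f_d_apply])
      (by rw [← hom_f_d_apply, d_intervalSphereGen₁, app_f_map_apply])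
      (by rw [← comp_app_f_apply, sq.w, comp_app_f_apply, intervalSphereToDisk_gen₁,
        app_f_map_apply])
    refine ⟨⟨persistentDiskDesc x, intervalSphere_hom_ext ?_ ?_, persistentDisk_hom_ext ?_⟩⟩
    · rw [comp_app_f_apply, intervalSphereToDisk_gen₀, hom_f_d_apply, persistentDiskDesc_gen, hx₁]
    · rw [comp_app_f_apply, intervalSphereToDisk_gen₁, app_f_map_apply, persistentDiskDesc_gen,
        hx₃]
    · rw [comp_app_f_apply, persistentDiskDesc_gen, hx₂]

/-- One implication suffices: the hypothesis is already forced by lifting against `𝕊^0_{[s,∞)} ⟶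
𝔻^0_s`. -/
lemma hasLiftingProperty_intervalSphereToDisk_zero {s t : ℝ≥0} (h : s < t)
    (hf : ∀ (z : (X.obj s).X 0) (_ : (X.obj s).d 0 1 z = 0) (_ : (f.app s).f 0 z = 0), z = 0) :
    HasLiftingProperty (intervalSphereToDisk 0 h) f := by
  refine ⟨fun {u v} sq ↦ ?_⟩
  have hv : v = 0 := (isZero_persistentDisk_zero s).eq_of_src _ _
  have hu : u = 0 := intervalSphere_zero_hom_ext (hf _
    (by rw [← hom_f_d_apply, d_intervalSphereGen₀, map_zero])
    (by
      rw [← comp_app_f_apply, sq.w, hv, comp_zero]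
      rfl))
  exact ⟨⟨0, by rw [comp_zero, hu], by rw [zero_comp, hv]⟩⟩

lemma setI_rlp_iff : setI.rlp f ↔ IsDegreewiseTrivialFibration f := by
  constructor
  · intro hf
    exact
      { eq_zero s := (hasLiftingProperty_intervalSphereInftyToDisk_zero_iff f s).1
          (hf _ (intervalSphereInftyToDisk_mem_setI _ _))
        exists_primitive s k := (hasLiftingProperty_intervalSphereInftyToDisk_succ_iff f k s).1
          (hf _ (intervalSphereInftyToDisk_mem_setI _ _))
        exists_lift h k := (hasLiftingProperty_intervalSphereToDisk_succ_iff f k h).1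
          (hf _ (intervalSphereToDisk_mem_setI _ h)) }
  · rintro hf _ _ _ (⟨⟨k, ⟨s, t⟩, h⟩⟩ | ⟨⟨k, s⟩⟩)
    · cases k with
      | zero => exact hasLiftingProperty_intervalSphereToDisk_zero f h (hf.eq_zero s)
      | succ k =>
        exact (hasLiftingProperty_intervalSphereToDisk_succ_iff f k h).2 (hf.exists_lift h k)
    · cases k with
      | zero => exact (hasLiftingProperty_intervalSphereInftyToDisk_zero_iff f s).2 (hf.eq_zero s)
      | succ k =>
        exact (hasLiftingProperty_intervalSphereInftyToDisk_succ_iff f k s).2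
          (hf.exists_primitive s k)

end


/-! ### Quasi-isomorphisms in terms of elements -/

section

variable {X Y : Ch} (f : X ⟶ Y) (i j k : ℕ)

/-- The linear map from the free module on the elements of `M` that is given by a function. -/
def freeDesc {M N : ModuleCat.{0} ℚ} (φ : M → N) : ModuleCat.of ℚ (M →₀ ℚ) ⟶ N :=
  ModuleCat.ofHom (Finsupp.linearCombination ℚ φ)

@[simp]
lemma freeDesc_single {M N : ModuleCat.{0} ℚ} (φ : M → N) (m : M) :
    freeDesc φ (Finsupp.single m (1 : ℚ)) = φ m :=
  (Finsupp.linearCombination_single ..).trans (one_smul ..)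

lemma freeDesc_hom_ext {M N : ModuleCat.{0} ℚ} {φ ψ : ModuleCat.of ℚ (M →₀ ℚ) ⟶ N}
    (h : ∀ m : M, φ (Finsupp.single m (1 : ℚ)) = ψ (Finsupp.single m (1 : ℚ))) : φ = ψ :=
  ModuleCat.hom_ext (Finsupp.lhom_ext' fun m ↦ LinearMap.ext_ring (h m))

lemma epi_freeDesc_id (M : ModuleCat.{0} ℚ) : Epi (freeDesc (fun m : M ↦ m)) :=
  (ModuleCat.epi_iff_surjective _).2 fun m ↦ ⟨_, freeDesc_single _ m⟩

/-- The criterion up to refinements tests on all objects `A`. Elements are the case `A = ℚ`;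
conversely, non-linear choices over the elements of `A` become a linear map on the free module
covering `A`. -/
lemma mono_homologyMap_iff_elements (hi : (ComplexShape.up ℕ).prev j = i)
    (hk : (ComplexShape.up ℕ).next j = k) :
    Mono (HomologicalComplex.homologyMap f j) ↔
      ∀ (z : X.X j) (y : Y.X i) (_ : X.d j k z = 0) (_ : Y.d i j y = f.f j z),
        ∃ x : X.X i, X.d i j x = z := by
  rw [HomologicalComplex.mono_homologyMap_iff_up_to_refinements f i j k hi hk]
  constructor
  · intro H z y hz hy
    obtain ⟨A, π, _, x, hx⟩ := H (ofElement z)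
      (Q_hom_ext ((congrArg (X.d j k) (ofElement_apply_one z)).trans hz)) (ofElement y)
      (Q_hom_ext ((congrArg (f.f j) (ofElement_apply_one z)).trans
        (hy.symm.trans (congrArg (Y.d i j) (ofElement_apply_one y)).symm)))
    obtain ⟨a, ha⟩ := (ModuleCat.epi_iff_surjective π).1 inferInstance (1 : ℚ)
    refine ⟨x a, (ConcreteCategory.congr_hom hx a).symm.trans ?_⟩
    exact (congrArg (ofElement z) ha).trans (ofElement_apply_one z)
  · intro H A z hz y hy
    choose x hx using fun a ↦ H (z a) (y a) (ConcreteCategory.congr_hom hz a)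
      (ConcreteCategory.congr_hom hy a).symm
    refine ⟨_, freeDesc (fun a : A ↦ a), epi_freeDesc_id A, freeDesc x, freeDesc_hom_ext ?_⟩
    intro a
    exact (congrArg z (freeDesc_single _ a)).trans
      ((hx a).symm.trans (congrArg (X.d i j) (freeDesc_single x a)).symm)

lemma epi_homologyMap_iff_elements (hi : (ComplexShape.up ℕ).prev j = i)
    (hk : (ComplexShape.up ℕ).next j = k) :
    Epi (HomologicalComplex.homologyMap f j) ↔
      ∀ (y : Y.X j) (_ : Y.d j k y = 0), ∃ (z : X.X j) (y' : Y.X i),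
        X.d j k z = 0 ∧ f.f j z + Y.d i j y' = y := by
  rw [HomologicalComplex.epi_homologyMap_iff_up_to_refinements f i j k hi hk]
  constructor
  · intro H y hy
    obtain ⟨A, π, _, z, hz, y', h⟩ := H (ofElement y)
      (Q_hom_ext ((congrArg (Y.d j k) (ofElement_apply_one y)).trans hy))
    obtain ⟨a, ha⟩ := (ModuleCat.epi_iff_surjective π).1 inferInstance (1 : ℚ)
    refine ⟨z a, y' a, ConcreteCategory.congr_hom hz a,
      (ConcreteCategory.congr_hom h a).symm.trans ?_⟩
    exact (congrArg (ofElement y) ha).trans (ofElement_apply_one y)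
  · intro H A y hy
    choose z y' hz h using fun a ↦ H (y a) (ConcreteCategory.congr_hom hy a)
    refine ⟨_, freeDesc (fun a : A ↦ a), epi_freeDesc_id A, freeDesc z, freeDesc_hom_ext ?_,
      freeDesc y', freeDesc_hom_ext ?_⟩
    · intro a
      exact (congrArg (X.d j k) (freeDesc_single z a)).trans (hz a)
    · intro a
      exact (congrArg y (freeDesc_single _ a)).trans ((h a).symm.trans (congrArg₂ (· + ·)
        (congrArg (f.f j) (freeDesc_single z a))
        (congrArg (Y.d i j) (freeDesc_single y' a))).symm)

lemma quasiIsoAt_iff_elements (hi : (ComplexShape.up ℕ).prev j = i)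
    (hk : (ComplexShape.up ℕ).next j = k) :
    QuasiIsoAt f j ↔
      (∀ (z : X.X j) (y : Y.X i) (_ : X.d j k z = 0) (_ : Y.d i j y = f.f j z),
        ∃ x : X.X i, X.d i j x = z) ∧
      ∀ (y : Y.X j) (_ : Y.d j k y = 0), ∃ (z : X.X j) (y' : Y.X i),
        X.d j k z = 0 ∧ f.f j z + Y.d i j y' = y := by
  rw [quasiIsoAt_iff_isIso_homologyMap, ← mono_homologyMap_iff_elements f i j k hi hk,
    ← epi_homologyMap_iff_elements f i j k hi hk]
  exact ⟨fun _ ↦ ⟨inferInstance, inferInstance⟩, fun ⟨_, _⟩ ↦ isIso_of_mono_of_epi _⟩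

end

/-- The predecessor of `0` in `ComplexShape.up ℕ` is `0` itself, so this is the differential into
degree `0`. -/
lemma d_zero_zero (X : Ch) (x : X.X 0) : X.d 0 0 x = 0 := by
  rw [X.shape 0 0 (by simp)]
  rfl

/-- The elementwise description of the quasi-isomorphisms of cochain complexes. -/
lemma quasiIso_iff_elements {X Y : Ch} (f : X ⟶ Y) :
    QuasiIso f ↔
      (∀ (z : X.X 0) (_ : X.d 0 1 z = 0) (_ : f.f 0 z = 0), z = 0) ∧
      (∀ (k : ℕ) (z : X.X (k + 1)) (y : Y.X k) (_ : X.d (k + 1) (k + 2) z = 0)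
        (_ : Y.d k (k + 1) y = f.f (k + 1) z), ∃ x : X.X k, X.d k (k + 1) x = z) ∧
      (∀ (y : Y.X 0) (_ : Y.d 0 1 y = 0), ∃ z : X.X 0, X.d 0 1 z = 0 ∧ f.f 0 z = y) ∧
      (∀ (k : ℕ) (y : Y.X (k + 1)) (_ : Y.d (k + 1) (k + 2) y = 0),
        ∃ (z : X.X (k + 1)) (y' : Y.X k), X.d (k + 1) (k + 2) z = 0 ∧
          f.f (k + 1) z + Y.d k (k + 1) y' = y) := by
  have h₀ := quasiIsoAt_iff_elements f 0 0 1 (by simp) (by simp)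
  have h₁ (k : ℕ) := quasiIsoAt_iff_elements f k (k + 1) (k + 2) (by simp) (by simp)
  constructor
  · intro hf
    have H₀ := h₀.1 inferInstance
    have H₁ (k : ℕ) := (h₁ k).1 inferInstance
    refine ⟨fun z hz hfz ↦ ?_, fun k ↦ (H₁ k).1, fun y hy ↦ ?_, fun k ↦ (H₁ k).2⟩
    · obtain ⟨x, rfl⟩ := H₀.1 z 0 hz (by rw [map_zero, hfz])
      exact d_zero_zero X x
    · obtain ⟨z, y', hz, h⟩ := H₀.2 y hy
      exact ⟨z, hz, by rw [← h, d_zero_zero, add_zero]⟩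
  · rintro ⟨H₁, H₂, H₃, H₄⟩
    refine ⟨fun k ↦ ?_⟩
    cases k with
    | zero =>
      refine h₀.2 ⟨fun z y hz hy ↦ ⟨0, ?_⟩, fun y hy ↦ ?_⟩
      · rw [map_zero, H₁ z hz (by rw [← hy, d_zero_zero])]
      · obtain ⟨z, hz, hfz⟩ := H₃ y hy
        exact ⟨z, 0, hz, by rw [map_zero, add_zero, hfz]⟩
    | succ k => exact (h₁ k).2 ⟨H₂ k, H₄ k⟩

/-! ### Trivial fibrations are the fibrations that are weak equivalences -/

variable {X Y : PCh} {f : X ⟶ Y}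

lemma IsDegreewiseTrivialFibration.exists_cocycle (hf : IsDegreewiseTrivialFibration f)
    (s : ℝ≥0) (k : ℕ) (y : (Y.obj s).X k) (hy : (Y.obj s).d k (k + 1) y = 0) :
    ∃ z : (X.obj s).X k, (X.obj s).d k (k + 1) z = 0 ∧ (f.app s).f k z = y :=
  hf.exists_primitive s k 0 y (map_zero _) (by rw [hy, map_zero])

lemma IsDegreewiseTrivialFibration.surjective (hf : IsDegreewiseTrivialFibration f)
    (s : ℝ≥0) (k : ℕ) : Function.Surjective ((f.app s).f k) := by
  intro y
  obtain ⟨z, hz, hfz⟩ := hf.exists_cocycle s (k + 1) ((Y.obj s).d k (k + 1) y) (d_d_apply ..)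
  obtain ⟨x, -, hx⟩ := hf.exists_primitive s k z y hz hfz.symm
  exact ⟨x, hx⟩

lemma IsDegreewiseTrivialFibration.isDegreewiseFibration
    (hf : IsDegreewiseTrivialFibration f) : IsDegreewiseFibration f where
  surjective := hf.surjective
  exists_lift {s t} h k y x hxy := by
    -- The pair `(d y, d x)` is first lifted to a cocycle `z`, which then serves as the prescribed
    -- differential.
    obtain ⟨z, hz, hfz, hzx⟩ := hf.exists_lift h (k + 1) 0 ((Y.obj s).d k (k + 1) y)
      ((X.obj t).d k (k + 1) x) (map_zero _) (by rw [d_d_apply, map_zero])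
      (by rw [d_d_apply, map_zero]) (by rw [hom_f_d_apply, hom_f_d_apply, hxy])
    obtain ⟨x', -, hx'⟩ := hf.exists_lift h k z y x hz hfz.symm hzx.symm hxy
    exact ⟨x', hx'⟩

lemma IsDegreewiseTrivialFibration.quasiIso (hf : IsDegreewiseTrivialFibration f) (s : ℝ≥0) :
    QuasiIso (f.app s) := by
  rw [quasiIso_iff_elements]
  refine ⟨hf.eq_zero s, fun k z y hz hy ↦ ?_, fun y hy ↦ hf.exists_cocycle s 0 y hy,
    fun k y hy ↦ ?_⟩
  · obtain ⟨x, hx, -⟩ := hf.exists_primitive s k z y hz hy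
    exact ⟨x, hx⟩
  · obtain ⟨z, hz, hfz⟩ := hf.exists_cocycle s (k + 1) y hy
    exact ⟨z, 0, hz, by rw [map_zero, add_zero, hfz]⟩


/-- A quasi-isomorphism that is surjective in each degree has the right lifting property
against the maps `S^k ⟶ D^k`. -/
lemma exists_primitive_of_quasiIso {X Y : Ch} (f : X ⟶ Y) (hf : ∀ k, Function.Surjective (f.f k))
    [QuasiIso f] (k : ℕ) (z : X.X (k + 1)) (y : Y.X k) (hz : X.d (k + 1) (k + 2) z = 0)
    (hy : Y.d k (k + 1) y = f.f (k + 1) z) :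
    ∃ x : X.X k, X.d k (k + 1) x = z ∧ f.f k x = y := by
  obtain ⟨-, H₂, H₃, H₄⟩ := (quasiIso_iff_elements f).1 inferInstance
  obtain ⟨x₀, rfl⟩ := H₂ k z y hz hy
  -- The primitive `x₀` has the right differential; only its image must be corrected, by a cocycle.
  suffices ∃ x₁ : X.X k, X.d k (k + 1) x₁ = 0 ∧ f.f k x₁ = y - f.f k x₀ by
    obtain ⟨x₁, h₁, h₂⟩ := this
    exact ⟨x₁ + x₀, by rw [map_add, h₁, zero_add], by rw [map_add, h₂, sub_add_cancel]⟩
  have h : Y.d k (k + 1) (y - f.f k x₀) = 0 := by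
    rw [map_sub, hy, ← hom_f_d_apply, sub_self]
  cases k with
  | zero => exact H₃ _ h
  | succ k =>
    obtain ⟨c, y', hc, hy'⟩ := H₄ k _ h
    -- Cohomology reaches the target up to `d y'`; surjectivity lifts `y'`, which absorbs this
    -- coboundary.
    obtain ⟨x', rfl⟩ := hf k y'
    refine ⟨c + X.d k (k + 1) x', by rw [map_add, hc, d_d_apply, add_zero], ?_⟩
    rw [map_add, hom_f_d_apply, hy']

lemma IsDegreewiseFibration.isDegreewiseTrivialFibration (hf : IsDegreewiseFibration f)
    (hf' : ∀ s, QuasiIso (f.app s)) : IsDegreewiseTrivialFibration f := by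
  have eq_zero (s : ℝ≥0) := ((quasiIso_iff_elements (f.app s)).1 (hf' s)).1
  have exists_primitive (s : ℝ≥0) :=
    exists_primitive_of_quasiIso (f.app s) (hf.surjective s)
  refine ⟨eq_zero, exists_primitive, fun {s t} h k z y x hz hy hx hxy ↦ ?_⟩
  obtain ⟨x₀, rfl, rfl⟩ := exists_primitive s k z y hz hy
  -- The element `x₀` solves the problem at time `s`. Its defect at time `t` is a cocycle in the
  -- kernel of `f(t)`, to be lifted to a cocycle in the kernel of `f(s)`.
  suffices ∃ u : (X.obj s).X k, (X.obj s).d k (k + 1) u = 0 ∧ (f.app s).f k u = 0 ∧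
      (X.map (homOfLE h.le)).f k u = x - (X.map (homOfLE h.le)).f k x₀ by
    obtain ⟨u, h₁, h₂, h₃⟩ := this
    exact ⟨u + x₀, by rw [map_add, h₁, zero_add], by rw [map_add, h₂, zero_add],
      by rw [map_add, h₃, sub_add_cancel]⟩
  have h₁ : (X.obj t).d k (k + 1) (x - (X.map (homOfLE h.le)).f k x₀) = 0 := by
    rw [map_sub, hx, hom_f_d_apply, sub_self]
  have h₂ : (f.app t).f k (x - (X.map (homOfLE h.le)).f k x₀) = 0 := by
    rw [map_sub, hxy, app_f_map_apply, sub_self]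
  generalize x - (X.map (homOfLE h.le)).f k x₀ = w at h₁ h₂
  cases k with
  | zero => exact ⟨0, map_zero _, map_zero _, by rw [map_zero, eq_zero t w h₁ h₂]⟩
  | succ k =>
    -- The kernel of `f(t)` is acyclic, so the defect is `d v` with `v` in the kernel. Lifting `v`,
    -- rather than the defect, ensures that the lift `d v'` is closed.
    obtain ⟨v, rfl, hv⟩ := exists_primitive t k w 0 h₁ (by rw [h₂, map_zero])
    obtain ⟨v', hfv', rfl⟩ := hf.exists_lift h k 0 v (by rw [hv, map_zero])
    exact ⟨(X.obj s).d k (k + 1) v', d_d_apply .., by rw [hom_f_d_apply, hfv', map_zero],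
      by rw [hom_f_d_apply]⟩

lemma setI_rlp_eq : setI.rlp = setJ.rlp ⊓ pointwiseQuasiIso := by
  ext X Y f
  rw [setI_rlp_iff]
  refine ⟨fun hf ↦ ⟨(setJ_rlp_iff f).2 hf.isDegreewiseFibration, fun s ↦ ?_⟩,
    fun ⟨hf, hf'⟩ ↦ ((setJ_rlp_iff f).1 hf).isDegreewiseTrivialFibration fun s ↦ ?_⟩
  · exact (HomologicalComplex.mem_quasiIso_iff ..).2 (hf.quasiIso s)
  · exact (HomologicalComplex.mem_quasiIso_iff ..).1 (hf' s)

/-! ### Contractible disks and lifting against degreewise surjections -/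

section

variable {X : Ch} {k : ℕ} (x : X.X k)

/-- The nonzero component of the contracting homotopy of `diskDesc x`. -/
def diskContraction : (disk (k + 1)).X (k + 1) ⟶ X.X k :=
  (HomologicalComplex.doubleXIso₁ (c := ComplexShape.up ℕ) (𝟙 Q) (i₀ := k) (i₁ := k + 1) rfl
    (by simp)).hom ≫ ofElement x

lemma d_comp_diskContraction :
    (disk (k + 1)).d k (k + 1) ≫ diskContraction x = (diskDesc x).f k := by
  have h₁ : (disk (k + 1)).d k (k + 1) = _ := HomologicalComplex.double_d
    (c := ComplexShape.up ℕ) (𝟙 Q) (i₀ := k) (i₁ := k + 1) rfl (by simp)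
  have h₂ : (diskDesc x).f k = _ := HomologicalComplex.mkHomFromDouble_f₀ ..
  rw [h₁, h₂, diskContraction, Category.id_comp]
  exact (Category.assoc ..).trans (congrArg _ (Iso.inv_hom_id_assoc ..))

/-- Any morphism from a disk is null-homotopic. -/
def diskDescHomotopy : Homotopy (diskDesc x) 0 :=
  let h (i j : ℕ) : (disk (k + 1)).X i ⟶ X.X j :=
    if hij : i = k + 1 ∧ j = k then
      ((disk (k + 1)).XIsoOfEq hij.1).hom ≫ diskContraction x ≫ (X.XIsoOfEq hij.2.symm).hom
    else 0
  (Homotopy.ofEq (disk_hom_ext (by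
    have h₁ : (Homotopy.nullHomotopicMap h).f k = (diskDesc x).f k := by
      -- In degree `k` only the summand `d ≫ h` survives, since `h` is nonzero only from degree `k +
      -- 1` to `k`.
      have : h k ((ComplexShape.up ℕ).prev k) = 0 := dif_neg (by simp)
      rw [Homotopy.nullHomotopicMap, ← d_comp_diskContraction]
      simp [dNext, prevD, h]
    rw [h₁]))).trans
    (Homotopy.nullHomotopy h (fun i j hij ↦ dif_neg (by
      rintro ⟨rfl, rfl⟩
      simp at hij)))

/-- Any two morphisms from a disk are homotopic. -/
lemma nonempty_homotopy_of_disk (f g : disk (k + 1) ⟶ X) : Nonempty (Homotopy f g) := by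
  have (f : disk (k + 1) ⟶ X) : diskDesc (f.f k (diskGen k)) = f :=
    disk_hom_ext (diskDesc_gen _)
  rw [← this f, ← this g]
  exact ⟨(diskDescHomotopy _).trans (diskDescHomotopy _).symm⟩

end

/-- The morphisms of cochain complexes that are surjective in each degree. -/
def degreewiseSurjective : MorphismProperty Ch :=
  fun _ _ f ↦ ∀ k, Function.Surjective (f.f k)

lemma degreewiseSurjective_of_exists_lift {X Y : Ch} (f : X ⟶ Y)
    (hf : ∀ (k : ℕ) (φ : disk (k + 1) ⟶ Y), ∃ ψ, ψ ≫ f = φ) : degreewiseSurjective f := by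
  intro k y
  obtain ⟨ψ, hψ⟩ := hf k (diskDesc y)
  exact ⟨ψ.f k (diskGen k), by rw [← comp_f_apply, hψ, diskDesc_gen]⟩

-- Lifting a pair of maps from a disk to the path object amounts to giving a homotopy between them.
open HomologicalComplex in
lemma degreewiseSurjective_pathObject (X : Ch) :
    degreewiseSurjective (biprod.lift (pathObject.π₀ X) (pathObject.π₁ X)) := by
  refine degreewiseSurjective_of_exists_lift _ fun k φ ↦ ?_
  obtain ⟨h⟩ := nonempty_homotopy_of_disk (φ ≫ biprod.fst) (φ ≫ biprod.snd)
  exact ⟨pathObject.lift _ _ h, biprod.hom_ext _ _ (by simp) (by simp)⟩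

/-- Lifting against `A ⟶ 0` gives a retraction `r`; lifting against the path fibration of `B` gives
a homotopy from `r ≫ g` to the identity. -/
lemma quasiIso_of_degreewiseSurjective_llp {A B : Ch} (g : A ⟶ B)
    (hg : degreewiseSurjective.llp g) : QuasiIso g := by
  have sq₁ : CommSq (𝟙 A) g (0 : A ⟶ 0) 0 := ⟨by simp⟩
  have := hg (0 : A ⟶ 0) (fun k y ↦ ⟨0, (ModuleCat.isZero_iff_subsingleton.1
    ((HomologicalComplex.eval _ _ k).map_isZero (isZero_zero Ch))).elim _ _⟩)
  let r := sq₁.lift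
  have hr : g ≫ r = 𝟙 A := sq₁.fac_left
  have sq₂ : CommSq (g ≫ HomologicalComplex.pathObject.ι B) g
      (biprod.lift (HomologicalComplex.pathObject.π₀ B) (HomologicalComplex.pathObject.π₁ B))
      (biprod.lift (r ≫ g) (𝟙 B)) :=
    ⟨biprod.hom_ext _ _ (by simp [reassoc_of% hr]) (by simp)⟩
  have := hg _ (degreewiseSurjective_pathObject B)
  obtain ⟨l, hl⟩ : ∃ l, l ≫ biprod.lift _ _ = _ := ⟨sq₂.lift, sq₂.fac_right⟩
  have h₀ : l ≫ HomologicalComplex.pathObject.π₀ B = r ≫ g := by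
    rw [← biprod.lift_fst (HomologicalComplex.pathObject.π₀ B)
      (HomologicalComplex.pathObject.π₁ B), ← Category.assoc, hl, biprod.lift_fst]
  have h₁ : l ≫ HomologicalComplex.pathObject.π₁ B = 𝟙 B := by
    rw [← biprod.lift_snd (HomologicalComplex.pathObject.π₀ B)
      (HomologicalComplex.pathObject.π₁ B), ← Category.assoc, hl, biprod.lift_snd]
  let e : HomotopyEquiv A B :=
    { hom := g
      inv := r
      homotopyHomInvId := Homotopy.ofEq hr
      homotopyInvHomId := (Homotopy.ofEq h₀.symm).trans
        (((HomologicalComplex.pathObject.homotopy₀₁ B (fun i ↦ ⟨i + 1, by simp⟩)).compLeft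
          l).trans (Homotopy.ofEq h₁)) }
  exact (HomologicalComplex.mem_quasiIso_iff ..).1
    (homotopyEquivalences_le_quasiIso _ _ g ⟨e, rfl⟩)

/-! ### The right adjoint of evaluation at a time -/

section

variable (r : ℝ≥0)

/-- The projection to `X` of the value at `s` of the right adjoint of the evaluation at `r`. -/
def evaluationRightAdjointπ (X : Ch) {s : ℝ≥0} (h : s ⟶ r) :
    ((evaluationRightAdjoint Ch r).obj X).obj s ⟶ X :=
  Pi.π (fun _ : s ⟶ r ↦ X) h

instance isIso_evaluationRightAdjointπ (X : Ch) {s : ℝ≥0} (h : s ⟶ r) :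
    IsIso (evaluationRightAdjointπ r X h) := by
  refine ⟨Pi.lift fun _ ↦ 𝟙 X, Pi.hom_ext _ _ fun h' ↦ ?_, Pi.lift_π _ _⟩
  obtain rfl : h = h' := Subsingleton.elim _ _
  exact (Category.assoc ..).trans ((congrArg _ (Pi.lift_π _ _)).trans
    ((Category.comp_id _).trans (Category.id_comp _).symm))

lemma isZero_evaluationRightAdjoint_obj (X : Ch) {s : ℝ≥0} (h : ¬ s ≤ r) :
    IsZero (((evaluationRightAdjoint Ch r).obj X).obj s) := by
  rw [IsZero.iff_id_eq_zero]
  exact Pi.hom_ext _ _ fun f ↦ (h (leOfHom f)).elim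

lemma evaluationRightAdjoint_map_app_π {X Y : Ch} (f : X ⟶ Y) {s : ℝ≥0} (h : s ⟶ r) :
    ((evaluationRightAdjoint Ch r).map f).app s ≫ evaluationRightAdjointπ r Y h =
      evaluationRightAdjointπ r X h ≫ f :=
  Pi.lift_π _ _

lemma isIso_evaluationRightAdjoint_obj_map (X : Ch) {s t : ℝ≥0} (g : s ⟶ t) (h : t ≤ r) :
    IsIso (((evaluationRightAdjoint Ch r).obj X).map g) := by
  have h₁ : ((evaluationRightAdjoint Ch r).obj X).map g ≫
      evaluationRightAdjointπ r X (homOfLE h) = evaluationRightAdjointπ r X (g ≫ homOfLE h) :=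
    Pi.lift_π _ _
  have : IsIso (((evaluationRightAdjoint Ch r).obj X).map g ≫
      evaluationRightAdjointπ r X (homOfLE h)) := by
    rw [h₁]
    infer_instance
  exact IsIso.of_isIso_comp_right _ (evaluationRightAdjointπ r X (homOfLE h))

lemma bijective_of_isIso {X Y : Ch} (f : X ⟶ Y) [IsIso f] (k : ℕ) : Function.Bijective (f.f k) :=
  (ConcreteCategory.isIso_iff_bijective (f.f k)).1
    (inferInstanceAs (IsIso ((HomologicalComplex.eval _ _ k).map f)))

lemma subsingleton_of_isZero {X : Ch} (hX : IsZero X) (k : ℕ) : Subsingleton (X.X k) :=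
  ModuleCat.isZero_iff_subsingleton.1 ((HomologicalComplex.eval _ _ k).map_isZero hX)

/-- The adjoint sends `X` to `X` at times `≤ r`, with invertible transition maps, and to zero later.
If `t ≤ r`, the element at time `t` determines the lift; otherwise time `t` imposes no condition. -/
lemma setJ_rlp_evaluationRightAdjoint_map {X Y : Ch} (f : X ⟶ Y) (hf : degreewiseSurjective f) :
    setJ.rlp ((evaluationRightAdjoint Ch r).map f) := by
  rw [setJ_rlp_iff]
  have surjective (s : ℝ≥0) (k : ℕ) :
      Function.Surjective ((((evaluationRightAdjoint Ch r).map f).app s).f k) := by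
    intro y
    by_cases h : s ≤ r
    · have hX := bijective_of_isIso (evaluationRightAdjointπ r X (homOfLE h)) k
      have hY := bijective_of_isIso (evaluationRightAdjointπ r Y (homOfLE h)) k
      obtain ⟨x, hx⟩ := hf k ((evaluationRightAdjointπ r Y (homOfLE h)).f k y)
      obtain ⟨x, rfl⟩ := hX.2 x
      refine ⟨x, hY.1 (Eq.trans ?_ hx)⟩
      exact ConcreteCategory.congr_hom (HomologicalComplex.congr_hom
        (evaluationRightAdjoint_map_app_π r f (homOfLE h)) k) x
    · exact ⟨0, (subsingleton_of_isZero (isZero_evaluationRightAdjoint_obj r Y h) k).elim _ _⟩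
  refine ⟨surjective, fun {s t} h k y x hxy ↦ ?_⟩
  by_cases ht : t ≤ r
  · have := isIso_evaluationRightAdjoint_obj_map r X (homOfLE h.le) ht
    have := isIso_evaluationRightAdjoint_obj_map r Y (homOfLE h.le) ht
    obtain ⟨x', rfl⟩ := (bijective_of_isIso
      (((evaluationRightAdjoint Ch r).obj X).map (homOfLE h.le)) k).2 x
    refine ⟨x', (bijective_of_isIso
      (((evaluationRightAdjoint Ch r).obj Y).map (homOfLE h.le)) k).1 ?_, rfl⟩
    rw [← hxy, app_f_map_apply]
  · obtain ⟨x', hx'⟩ := surjective s k y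
    exact ⟨x', hx', (subsingleton_of_isZero (isZero_evaluationRightAdjoint_obj r X ht) k).elim _ _⟩

end

/-! ### Trivial cofibrations and the model structure -/

lemma pointwiseQuasiIso_of_setJ_rlp_llp {X Y : PCh} (f : X ⟶ Y) (hf : setJ.rlp.llp f) :
    pointwiseQuasiIso f := fun r ↦
  quasiIso_of_degreewiseSurjective_llp _ fun _ _ p hp ↦
    ((evaluationAdjunctionLeft Ch r).hasLiftingProperty_iff f p).2
      (hf _ (setJ_rlp_evaluationRightAdjoint_map r p hp))

lemma setJ_rlp_llp_eq : setJ.rlp.llp = setI.rlp.llp ⊓ pointwiseQuasiIso := by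
  apply le_antisymm
  · refine le_inf (MorphismProperty.antitone_llp ?_)
      fun _ _ f hf ↦ pointwiseQuasiIso_of_setJ_rlp_llp f hf
    rw [setI_rlp_eq]
    exact inf_le_left
  · rintro X Y f ⟨hf, hf'⟩
    -- Retract argument: by two-out-of-three the second factor `d.p` is a weak equivalence, hence in
    -- `rlp 𝕀`. So `f` lifts against it and is a retract of `d.i`.
    let d := MorphismProperty.factorizationData setJ.rlp.llp setJ.rlp f
    have hp : setI.rlp d.p := by
      rw [setI_rlp_eq]
      refine ⟨d.hp, fun s ↦ ?_⟩
      refine MorphismProperty.of_precomp _ (d.i.app s) _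
        (pointwiseQuasiIso_of_setJ_rlp_llp _ d.hi s) ?_
      rw [← NatTrans.comp_app, d.fac]
      exact hf' s
    have := hf _ hp
    exact MorphismProperty.of_retract (RetractArrow.ofLeftLiftingProperty d.fac) d.hi

instance hasTwoOutOfThreeProperty_pointwiseQuasiIso :
    pointwiseQuasiIso.HasTwoOutOfThreeProperty where
  comp_mem _ _ hf hg s := MorphismProperty.comp_mem _ _ _ (hf s) (hg s)
  of_postcomp _ _ hg hfg s := MorphismProperty.of_postcomp _ _ _ (hg s) (hfg s)
  of_precomp _ _ hf hfg s := MorphismProperty.of_precomp _ _ _ (hf s) (hfg s)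

/-- The interval-sphere model structure. -/
@[reducible]
def intervalSphereModelCategory : ModelCategory PCh := by
  letI : CategoryWithFibrations PCh := ⟨setJ.rlp⟩
  letI : CategoryWithCofibrations PCh := ⟨setI.rlp.llp⟩
  letI : CategoryWithWeakEquivalences PCh := ⟨pointwiseQuasiIso⟩
  have h₁ : fibrations PCh = setJ.rlp := rfl
  have h₂ : cofibrations PCh = setI.rlp.llp := rfl
  have h₄ : trivialFibrations PCh = setI.rlp := setI_rlp_eq.symm
  have h₅ : trivialCofibrations PCh = setJ.rlp.llp := setJ_rlp_llp_eq.symm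
  have : (weakEquivalences PCh).HasTwoOutOfThreeProperty :=
    inferInstanceAs pointwiseQuasiIso.HasTwoOutOfThreeProperty
  have : MorphismProperty.IsWeakFactorizationSystem (cofibrations PCh) (trivialFibrations PCh) := by
    rw [h₂, h₄]
    exact ⟨MorphismProperty.rlp_llp_rlp _, rfl, inferInstance⟩
  have : MorphismProperty.IsWeakFactorizationSystem (trivialCofibrations PCh) (fibrations PCh) := by
    rw [h₁, h₅]
    exact ⟨MorphismProperty.rlp_llp_rlp _, rfl, inferInstance⟩
  exact ModelCategory.mk' PCh

end PersistentComplex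

end

theorem mainTheorem1 :
    ∃ _ : ModelCategory PersistentComplex.PCh,
      weakEquivalences PersistentComplex.PCh = PersistentComplex.pointwiseQuasiIso ∧
      IsCofibrantlyGeneratedBy PersistentComplex.PCh
        PersistentComplex.setI PersistentComplex.setJ := by
  let := PersistentComplex.intervalSphereModelCategory
  have h₁ : fibrations PersistentComplex.PCh = PersistentComplex.setJ.rlp := rfl
  have h₂ : cofibrations PersistentComplex.PCh = PersistentComplex.setI.rlp.llp := rfl
  have h₄ : trivialFibrations PersistentComplex.PCh = PersistentComplex.setI.rlp :=
    PersistentComplex.setI_rlp_eq.symm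
  have h₅ : trivialCofibrations PersistentComplex.PCh = PersistentComplex.setJ.rlp.llp :=
    PersistentComplex.setJ_rlp_llp_eq.symm
  refine ⟨inferInstance, rfl, ?_⟩
  exact
    { hasLimits := inferInstance
      hasColimits := inferInstance
      functorialFactorization₁ := by
        rw [h₂, h₄]
        infer_instance
      functorialFactorization₂ := by
        rw [h₁, h₅]
        infer_instance
      smallObjectArgument_I := inferInstance
      smallObjectArgument_J := inferInstance
      trivialFibrations_eq := h₄
      fibrations_eq := h₁ }
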